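/- Let $n\ge 0$ and $k$ be integers. Every $n\times n$ matrix $A$ with entries in $\{0,1\}$ and at most $n+k$ non-zero entries satisfies $|\det A|\le 2^{k/3}$. Moreover, the bound is attained whenever $3\mid k$ and $0\le k\le n$: the $n\times n$ block-diagonal matrix $\operatorname{diag}(C,\dots,C,1,\dots,1)$ with $k/3$ copies of $$C=\begin{pmatrix}1&1&0\\0&1&1\\1&0&1\end{pmatrix}$$ followed by $n-k$ diagonal entries equal to $1$ (none if $k=n$) has entries in $\{0,1\}$, exactly $n+k$ non-zero entries, and determinant $2^{k/3}$. -/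

import Mathlib

/-- The number of non-zero entries of a real square matrix. -/
noncomputable def numNonzero {n : ℕ} (A : Matrix (Fin n) (Fin n) ℝ) : ℕ :=
  {p : Fin n × Fin n | A p.1 p.2 ≠ 0}.ncard

/-- The `3 × 3` circulant matrix `C`. -/
def circulantC : Matrix (Fin 3) (Fin 3) ℝ :=
  !![1, 1, 0;
     0, 1, 1;
     1, 0, 1]

/-- The ordering of the rows and columns of `diag(C, …, C, 1, …, 1)`: row `a` of the `b`-th copy
of `C` has index `3 * b + a`, and the last `n - k` indices follow. -/
def blockIndexEquiv (n k : ℕ) (h3 : 3 ∣ k) (hk : k ≤ n) :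
    (Fin 3 × Fin (k / 3)) ⊕ Fin (n - k) ≃ Fin n :=
  (Equiv.sumCongr ((Equiv.prodComm _ _).trans finProdFinEquiv) (Equiv.refl _)).trans
    (finSumFinEquiv.trans (finCongr (by omega)))

/-- The `n × n` block-diagonal matrix `diag(C, …, C, 1, …, 1)` with `k / 3` copies of `C` and
`n - k` diagonal entries `1`; for `n = k` it is `diag(C, …, C)`. -/
def diagC (n k : ℕ) (h3 : 3 ∣ k) (hk : k ≤ n) : Matrix (Fin n) (Fin n) ℝ :=
  Matrix.reindex (blockIndexEquiv n k h3 hk) (blockIndexEquiv n k h3 hk)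
    (Matrix.fromBlocks (Matrix.blockDiagonal (fun _ : Fin (k / 3) => circulantC)) 0 0 1)

set_option linter.unusedSectionVars false

/-! Let a = 2^(-1/3). Among the zero-one matrices of a fixed size n that violate |det A| ≤ a^(n -
total A), take one with the fewest ones (`Critical`). Passing to a matrix with t fewer ones gains a
factor a^t, so no splitting det A = det B + det C with savings x and y can have a^x + a^y ≤ 1. Hence
no row or column has two ones or more than seven, and two rows share at most two ones, exactly two
only if both have four (`rowSum_ne_two`, `rowSum_le_seven`, `overlap_cases`).

Such a matrix nevertheless obeys the bound, by an estimate of the Gram determinant (det A)^2.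
Hadamard's factor d for a row with d ones suffices when d^3 ≤ 4^(d-1), leaving only d = 3. A row
with three ones meets at least six other rows, and `det_restrict_gram_insert_le` uses the neighbours
inserted before it to improve the factor 3. Averaging over insertion orders (`le_sum_of_insert_le`)
makes the improved factors telescope, and `meanLogGain_le` bounds their logarithmic mean by the
required (4/3) log 2. -/

namespace SparseDet

variable {ι : Type*} [Fintype ι] [DecidableEq ι]

/-! ### Pivots and cofactor expansion at constant size -/

/-- Replace row `r` by the `c`-th unit vector and column `c` by the `r`-th unit vector. -/
def piv {K : Type*} [CommRing K] (A : Matrix ι ι K) (r c : ι) : Matrix ι ι K :=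
  (A.updateRow r (Pi.single c 1)).updateCol c (Pi.single r 1)

theorem piv_apply {K : Type*} [CommRing K] (A : Matrix ι ι K) (r c i j : ι) :
    piv A r c i j = if j = c then (if i = r then 1 else 0) else if i = r then 0 else A i j := by
  unfold piv
  rw [Matrix.updateCol_apply, Matrix.updateRow_apply]
  simp only [Pi.single_apply]
  split_ifs <;> simp_all

/-- Once column c is the unit vector at r, the other entries of row r do not affect the determinant.
-/
theorem det_piv_eq_updateCol {K : Type*} [CommRing K] (A : Matrix ι ι K) (r c : ι) :
    (piv A r c).det = (A.updateCol c (Pi.single r 1)).det := by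
  have h : piv A r c = (A.updateCol c (Pi.single r 1)).updateRow r (Pi.single c 1) := by
    ext i j
    rw [piv_apply, Matrix.updateRow_apply, Matrix.updateCol_apply]
    simp only [Pi.single_apply]
    split_ifs <;> simp_all
  have h1 : ∀ B : Matrix ι ι K, (∀ i, B i c = if i = r then 1 else 0) →
      (B.updateRow r (Pi.single c 1)).det = B.det := by
    intro B hB
    rw [← Matrix.adjugate_apply]
    have := Matrix.det_eq_sum_mul_adjugate_col B c
    rw [this]
    simp [hB]
  rw [h, h1]
  intro i
  simp [Pi.single_apply]

theorem transpose_piv {K : Type*} [CommRing K] (A : Matrix ι ι K) (r c : ι) :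
    (piv A r c).transpose = piv A.transpose c r := by
  ext i j
  rw [Matrix.transpose_apply, piv_apply, piv_apply]
  simp only [Matrix.transpose_apply]
  split_ifs <;> simp_all

theorem det_piv_eq_updateRow {K : Type*} [CommRing K] (A : Matrix ι ι K) (r c : ι) :
    (piv A r c).det = (A.updateRow r (Pi.single c 1)).det := by
  rw [← Matrix.det_transpose, transpose_piv, det_piv_eq_updateCol, ← Matrix.det_transpose,
    Matrix.updateCol_transpose, Matrix.transpose_transpose]

theorem det_piv_eq_adjugate {K : Type*} [CommRing K] (A : Matrix ι ι K) (r c : ι) :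
    (piv A r c).det = A.adjugate c r := by
  rw [det_piv_eq_updateRow, Matrix.adjugate_apply]

theorem det_eq_sum_piv {K : Type*} [CommRing K] (A : Matrix ι ι K) (r : ι) :
    A.det = ∑ c, A r c * (piv A r c).det := by
  simp_rw [det_piv_eq_adjugate]
  exact Matrix.det_eq_sum_mul_adjugate_row A r

/-! ### Counting ones -/

/-- The sum of the entries of row `i`. -/
def rowSum (A : Matrix ι ι ℤ) (i : ι) : ℤ := ∑ j, A i j

/-- The sum of all entries. -/
def total (A : Matrix ι ι ℤ) : ℤ := ∑ i, rowSum A i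

/-- All entries are `0` or `1`. -/
def ZeroOne (A : Matrix ι ι ℤ) : Prop := ∀ i j, A i j = 0 ∨ A i j = 1

theorem total_transpose (A : Matrix ι ι ℤ) : total A.transpose = total A := by
  change ∑ i, ∑ j, A j i = ∑ i, ∑ j, A i j
  exact Finset.sum_comm

theorem ZeroOne.transpose {A : Matrix ι ι ℤ} (h : ZeroOne A) : ZeroOne A.transpose :=
  fun i j => h j i

theorem total_updateRow (A : Matrix ι ι ℤ) (r : ι) (v : ι → ℤ) :
    total (A.updateRow r v) = total A - rowSum A r + ∑ j, v j := by
  unfold total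
  rw [← Finset.add_sum_erase _ _ (Finset.mem_univ r),
    ← Finset.add_sum_erase Finset.univ (rowSum A) (Finset.mem_univ r)]
  have : ∀ i ∈ Finset.univ.erase r, rowSum (A.updateRow r v) i = rowSum A i := by
    intro i hi
    simp [rowSum, Matrix.updateRow_ne (Finset.ne_of_mem_erase hi)]
  have h : rowSum (A.updateRow r v) r = ∑ j, v j := by simp [rowSum]
  rw [Finset.sum_congr rfl this, h]
  ring

theorem total_updateCol (A : Matrix ι ι ℤ) (c : ι) (v : ι → ℤ) :
    total (A.updateCol c v) = total A - rowSum A.transpose c + ∑ j, v j := by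
  rw [← total_transpose, ← total_transpose A, ← Matrix.updateRow_transpose, total_updateRow]

theorem rowSum_updateCol (A : Matrix ι ι ℤ) (c : ι) (v : ι → ℤ) (i : ι) :
    rowSum (A.updateCol c v) i = rowSum A i - A i c + v i := by
  unfold rowSum
  rw [← Finset.add_sum_erase _ _ (Finset.mem_univ c),
    ← Finset.add_sum_erase Finset.univ (fun j => A i j) (Finset.mem_univ c)]
  have : ∀ j ∈ Finset.univ.erase c, A.updateCol c v i j = A i j := by
    intro j hj
    rw [Matrix.updateCol_ne (Finset.ne_of_mem_erase hj)]
  rw [Finset.sum_congr rfl this]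
  simp only [Matrix.updateCol_self]
  ring

theorem total_piv (A : Matrix ι ι ℤ) (r c : ι) :
    total (piv A r c) = total A - rowSum A r - rowSum A.transpose c + A r c + 1 := by
  unfold piv
  rw [total_updateCol, total_updateRow, ← Matrix.updateCol_transpose, rowSum_updateCol]
  simp [Matrix.transpose_apply]
  ring

theorem ZeroOne.updateRow {A : Matrix ι ι ℤ} (h : ZeroOne A) (r : ι) {v : ι → ℤ}
    (hv : ∀ j, v j = 0 ∨ v j = 1) : ZeroOne (A.updateRow r v) := by
  intro i j
  rw [Matrix.updateRow_apply]
  split_ifs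
  exacts [hv j, h i j]

theorem ZeroOne.piv {A : Matrix ι ι ℤ} (h : ZeroOne A) (r c : ι) : ZeroOne (piv A r c) := by
  intro i j
  rw [piv_apply]
  split_ifs
  exacts [Or.inr rfl, Or.inl rfl, Or.inl rfl, h i j]

theorem eq_single_of_sum_eq_one {f : ι → ℤ} (hf : ∀ j, f j = 0 ∨ f j = 1)
    (h : ∑ j, f j = 1) : ∃ p, f = Pi.single p 1 := by
  have h1 : ∃ p, f p = 1 := by
    by_contra! hc
    have : ∑ j, f j = 0 := Finset.sum_eq_zero fun j _ => (hf j).resolve_right (hc j)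
    omega
  obtain ⟨p, hp⟩ := h1
  refine ⟨p, ?_⟩
  rw [← Finset.add_sum_erase _ _ (Finset.mem_univ p), hp] at h
  have h0 : ∑ j ∈ Finset.univ.erase p, f j = 0 := by omega
  rw [Finset.sum_eq_zero_iff_of_nonneg
    (fun j _ => by rcases hf j with h | h <;> omega)] at h0
  ext j
  by_cases hj : j = p
  · simp [hj, hp]
  · simp [hj, h0 j (by simp [hj])]

theorem eq_single_add_single_of_sum_eq_two {f : ι → ℤ} (hf : ∀ j, f j = 0 ∨ f j = 1)
    (h : ∑ j, f j = 2) : ∃ p q, p ≠ q ∧ f = Pi.single p 1 + Pi.single q 1 := by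
  have h1 : ∃ p, f p = 1 := by
    by_contra! hc
    have : ∑ j, f j = 0 := Finset.sum_eq_zero fun j _ => (hf j).resolve_right (hc j)
    omega
  obtain ⟨p, hp⟩ := h1
  obtain ⟨q, hq⟩ := eq_single_of_sum_eq_one (f := f - Pi.single p 1) (by
    intro j
    by_cases hj : j = p
    · subst hj; simp [hp]
    · simpa [hj] using hf j) (by simp [Finset.sum_sub_distrib, h])
  refine ⟨q, p, ?_, by rw [← hq]; simp⟩
  rintro rfl
  have := congrFun hq q
  simp [hp] at this

/-! ### Row and column sums of a minimal counterexample -/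

/-- A zero-one matrix violating the bound `a ^ (n - total A)`, where `a ^ 3 = 1 / 2`, while every
zero-one matrix of the same size with a smaller number of ones satisfies it. -/
structure Critical (a : ℝ) (A : Matrix ι ι ℤ) : Prop where
  pos : 0 < a
  cube : a ^ 3 = 1 / 2
  zeroOne : ZeroOne A
  min : ∀ B : Matrix ι ι ℤ, ZeroOne B → total B < total A →
    |(B.det : ℝ)| ≤ a ^ ((Fintype.card ι : ℤ) - total B)
  bad : a ^ ((Fintype.card ι : ℤ) - total A) < |(A.det : ℝ)|

namespace Critical

variable {a : ℝ} {A : Matrix ι ι ℤ}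

theorem transpose (h : Critical a A) : Critical a A.transpose where
  pos := h.pos
  cube := h.cube
  zeroOne := h.zeroOne.transpose
  min := by rw [total_transpose]; exact h.min
  bad := by rw [total_transpose, Matrix.det_transpose]; exact h.bad

theorem lt_four_fifths (h : Critical a A) : a < 4 / 5 := by
  have h1 := h.cube
  have h2 := h.pos
  by_contra! hc
  nlinarith [mul_self_nonneg (a - 4 / 5), mul_nonneg (sub_nonneg.2 hc) (sq_nonneg a)]

/-- Minimality in its working form. Positivity of t makes B eligible for the minimality hypothesis.
-/
theorem le_of_total (h : Critical a A) {B : Matrix ι ι ℤ} (hB : ZeroOne B) (t : ℕ) (ht : 0 < t)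
    (hE : total B + t ≤ total A) :
    |(B.det : ℝ)| ≤ a ^ ((Fintype.card ι : ℤ) - total A) * a ^ t := by
  refine (h.min B hB (by omega)).trans ?_
  rw [← zpow_natCast, ← zpow_add₀ h.pos.ne']
  exact zpow_le_zpow_right_of_le_one₀ h.pos (by linarith [h.lt_four_fifths]) (by omega)

theorem false_of_le (h : Critical a A) {x : ℝ}
    (hx : |(A.det : ℝ)| ≤ a ^ ((Fintype.card ι : ℤ) - total A) * x) (hx1 : x ≤ 1) : False := by
  have h1 := h.bad
  have h2 : 0 < a ^ ((Fintype.card ι : ℤ) - total A) := zpow_pos h.pos _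
  nlinarith

theorem false_of_add_le (h : Critical a A) {x y b : ℝ} {B C : Matrix ι ι ℤ}
    (hb : b = a ^ ((Fintype.card ι : ℤ) - total A)) (hd : A.det = B.det + C.det)
    (hB : |(B.det : ℝ)| ≤ b * x) (hC : |(C.det : ℝ)| ≤ b * y) (hx : x + y ≤ 1) : False := by
  subst hb
  refine h.false_of_le (x := x + y) ?_ hx
  rw [hd, Int.cast_add, mul_add]
  exact (abs_add_le _ _).trans (add_le_add hB hC)

theorem det_ne_zero (h : Critical a A) : A.det ≠ 0 := by
  intro h0
  have h1 := h.bad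
  have h2 : 0 < a ^ ((Fintype.card ι : ℤ) - total A) := zpow_pos h.pos _
  rw [h0] at h1
  simp at h1
  linarith

theorem nonneg (h : Critical a A) (i j : ι) : 0 ≤ A i j := by
  rcases h.zeroOne i j with h | h <;> omega

theorem one_le_rowSum (h : Critical a A) (r : ι) : 1 ≤ rowSum A r := by
  by_contra! hc
  have h0 : ∑ j, A r j = 0 := by
    have : 0 ≤ rowSum A r := Finset.sum_nonneg fun j _ => h.nonneg r j
    unfold rowSum at *
    omega
  rw [Finset.sum_eq_zero_iff_of_nonneg (fun j _ => h.nonneg r j)] at h0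
  exact h.det_ne_zero (Matrix.det_eq_zero_of_row_eq_zero r fun j => h0 j (Finset.mem_univ j))

theorem det_eq_piv {B : Matrix ι ι ℤ} {r c : ι} (hr : B r = Pi.single c 1) :
    B.det = (piv B r c).det := by
  rw [det_piv_eq_updateRow, ← hr, Matrix.updateRow_eq_self]

/-- Pivoting at the only one of a row preserves the determinant and would delete any further ones of
its column. -/
theorem rowSum_transpose_eq_one (h : Critical a A) {r c : ι} (hr : rowSum A r = 1)
    (hc : A r c = 1) : rowSum A.transpose c = 1 := by
  by_contra hne
  have h1 := h.transpose.one_le_rowSum c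
  obtain ⟨p, hp⟩ := eq_single_of_sum_eq_one (h.zeroOne r) hr
  have hpc : p = c := by
    by_contra hpc
    rw [hp] at hc
    simp [Ne.symm hpc] at hc
  subst hpc
  refine h.false_of_le (x := a ^ 1) ?_ (by linarith [h.lt_four_fifths])
  rw [det_eq_piv hp]
  refine h.le_of_total (h.zeroOne.piv _ _) 1 one_pos ?_
  rw [total_piv]
  push_cast
  omega

/-- Otherwise subtracting row r from row s keeps the matrix zero-one and the determinant unchanged,
with fewer ones. -/
theorem not_row_le (h : Critical a A) {r s : ι} (hrs : r ≠ s) : ¬ ∀ j, A r j ≤ A s j := by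
  intro hle
  refine h.false_of_le (x := a ^ 1) ?_ (by linarith [h.lt_four_fifths])
  rw [← Matrix.det_updateRow_add_smul_self A hrs.symm (-1)]
  refine h.le_of_total (h.zeroOne.updateRow _ ?_) 1 one_pos ?_
  · intro j
    have := hle j
    have h1 := h.zeroOne r j
    have h2 := h.zeroOne s j
    simp only [Pi.add_apply, Pi.smul_apply, smul_eq_mul]
    omega
  · rw [total_updateRow]
    simp only [Pi.add_apply, Pi.smul_apply, Finset.sum_add_distrib, ← Finset.smul_sum]
    have := h.one_le_rowSum r
    unfold rowSum at *
    push_cast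
    simp only [smul_eq_mul]
    omega

theorem det_eq_add_of_row_eq {r p q : ι} {B : Matrix ι ι ℤ}
    (hr : B r = Pi.single p 1 + Pi.single q 1) :
    B.det = (piv B r p).det + (piv B r q).det := by
  rw [det_piv_eq_updateRow, det_piv_eq_updateRow, ← Matrix.det_updateRow_add, ← hr,
    Matrix.updateRow_eq_self]

/-- Row `r` has ones in columns `p, q` and column `p` has ones in rows `r, u`: after selecting the
entry `(r, q)`, the entry `(u, p)` is forced. -/
theorem abs_det_piv_le (h : Critical a A) {r p q u : ι} (hpq : p ≠ q) (hru : r ≠ u)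
    (hr : A r = Pi.single p 1 + Pi.single q 1)
    (hp : A.transpose p = Pi.single r 1 + Pi.single u 1) (t : ℕ) (ht : 0 < t)
    (hE : (t : ℤ) + 1 ≤ rowSum A.transpose q + rowSum A u) :
    |((piv A r q).det : ℝ)| ≤ a ^ ((Fintype.card ι : ℤ) - total A) * a ^ t := by
  have hAp : ∀ i, A i p = (Pi.single r 1 + Pi.single u 1 : ι → ℤ) i := fun i => congrFun hp i
  have huq : A u q = 0 := by
    rcases h.zeroOne u q with h0 | h1
    · exact h0
    · exfalso
      refine h.not_row_le hru fun j => ?_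
      rw [hr]
      by_cases hj : j = p
      · subst hj; simp [hAp, hpq, hru.symm]
      · by_cases hj' : j = q
        · subst hj'; simp [h1, hj]
        · simpa [hj, hj'] using h.nonneg u j
  have hcol : (piv A r q).transpose p = Pi.single u 1 := by
    ext i
    rw [Matrix.transpose_apply, piv_apply, if_neg hpq, hAp]
    by_cases hi : i = r
    · subst hi; simp [hru]
    · simp [hi]
  have hdet : (piv A r q).det = (piv (piv A r q) u p).det := by
    rw [← Matrix.det_transpose, det_eq_piv hcol, ← transpose_piv, Matrix.det_transpose]
  rw [hdet]
  refine h.le_of_total ((h.zeroOne.piv _ _).piv _ _) t ht ?_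
  have h1 : rowSum (piv A r q).transpose p = 1 := by
    unfold rowSum; rw [hcol]; simp
  have h2 : rowSum (piv A r q) u = rowSum A u := by
    have : (A.updateRow r (Pi.single q 1)) u = A u := Matrix.updateRow_ne hru.symm
    unfold piv
    rw [rowSum_updateCol]
    unfold rowSum
    rw [this, huq]
    simp [hru.symm]
  have h3 : piv A r q u p = 1 := by
    have := congrFun hcol u
    simpa using this
  have h4 : rowSum A r = 2 := by
    unfold rowSum; rw [hr]; simp [Finset.sum_add_distrib]
  have h5 : A r q = 1 := by rw [hr]; simp [hpq.symm]
  rw [total_piv, total_piv, h1, h2, h3, h4, h5]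
  omega

theorem two_le_of_rowSum (h : Critical a A) {r p : ι} (hr : 2 ≤ rowSum A r) (hp : A r p = 1) :
    2 ≤ rowSum A.transpose p := by
  have h1 := h.transpose.one_le_rowSum p
  by_contra! hc
  have := h.transpose.rowSum_transpose_eq_one (r := p) (c := r) (by omega) hp
  rw [Matrix.transpose_transpose] at this
  omega

/-- Let row `r` and column `p` meet and have two ones each, the other ones lying in column `q` and
row `u`. Then neither can column `q` have two ones, nor can `q` and `u` both have at least three. -/
theorem false_of_adjacent_two (h : Critical a A) {r p q u : ι} (hpq : p ≠ q) (hru : r ≠ u)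
    (hr : A r = Pi.single p 1 + Pi.single q 1)
    (hp : A.transpose p = Pi.single r 1 + Pi.single u 1)
    (hor : rowSum A.transpose q = 2 ∨ (3 ≤ rowSum A.transpose q ∧ 3 ≤ rowSum A u)) : False := by
  have ha := h.lt_four_fifths
  have ha0 := h.pos
  have ha3 := h.cube
  have hsr : rowSum A r = 2 := by
    unfold rowSum; rw [hr]; simp [Finset.sum_add_distrib]
  have hsp : rowSum A.transpose p = 2 := by
    unfold rowSum; rw [hp]; simp [Finset.sum_add_distrib]
  have hArp : A r p = 1 := by rw [hr]; simp [hpq]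
  have hArq : A r q = 1 := by rw [hr]; simp [hpq.symm]
  have hAup : A u p = 1 := by
    have := congrFun hp u
    simpa [hru.symm] using this
  have hu : 2 ≤ rowSum A u := by
    have := h.transpose.two_le_of_rowSum (r := p) (p := u) (by omega) hAup
    rwa [Matrix.transpose_transpose] at this
  rcases hor with hq | ⟨hq, hu3⟩
  · obtain ⟨x, y, hxy, hxq⟩ := eq_single_add_single_of_sum_eq_two (h.zeroOne.transpose q) hq
    have hr' : A r = Pi.single q 1 + Pi.single p 1 := by rw [hr, add_comm]
    have hrxy : r = x ∨ r = y := by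
      have := congrFun hxq r
      rw [Matrix.transpose_apply, hArq] at this
      by_contra! hc
      simp [hc.1, hc.2] at this
    obtain ⟨z, hrz, hqz⟩ : ∃ z, r ≠ z ∧ A.transpose q = Pi.single r 1 + Pi.single z 1 := by
      rcases hrxy with rfl | rfl
      · exact ⟨y, hxy, hxq⟩
      · exact ⟨x, hxy.symm, by rw [hxq, add_comm]⟩
    have hAzq : A z q = 1 := by
      have := congrFun hqz z
      simpa [hrz.symm] using this
    have hz : 2 ≤ rowSum A z := by
      have := h.transpose.two_le_of_rowSum (r := q) (p := z) (by omega) hAzq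
      rwa [Matrix.transpose_transpose] at this
    refine h.false_of_add_le (x := a ^ 3) (y := a ^ 3) rfl (det_eq_add_of_row_eq hr)
      (h.abs_det_piv_le hpq.symm hrz hr' hqz 3 (by norm_num) (by omega))
      (h.abs_det_piv_le hpq hru hr hp 3 (by norm_num) (by omega)) (by linarith)
  -- The plain pivot saves 2 + 2 - 2 = 2 ones, the forced double pivot 3 + 3 - 1 = 5, and a^2 + a^5
  -- = (3/2) a^2 < 1.
  · refine h.false_of_add_le (x := a ^ 2) (y := a ^ 5) rfl (det_eq_add_of_row_eq hr)
      (h.le_of_total (h.zeroOne.piv _ _) 2 (by norm_num) (by rw [total_piv]; push_cast; omega))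
      (h.abs_det_piv_le hpq hru hr hp 5 (by norm_num) (by omega)) ?_
    have : a ^ 5 = a ^ 2 / 2 := by
      rw [show a ^ 5 = a ^ 2 * a ^ 3 by ring, ha3]; ring
    nlinarith

/-- Expand along the row. If both columns have at least three ones, each term saves 2 + 3 - 2 = 3
ones, and 2 a^3 = 1. A column with two ones leads to `false_of_adjacent_two`, for A or its
transpose. -/
theorem rowSum_ne_two (h : Critical a A) (r : ι) : rowSum A r ≠ 2 := by
  intro hr2
  have key : ∀ p q : ι, p ≠ q → A r = Pi.single p 1 + Pi.single q 1 →
      rowSum A.transpose p = 2 → False := by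
    intro p q hpq hr hp2
    have hArp : A r p = 1 := by rw [hr]; simp [hpq]
    have hArq : A r q = 1 := by rw [hr]; simp [hpq.symm]
    obtain ⟨u, hru, hp⟩ : ∃ u, r ≠ u ∧ A.transpose p = Pi.single r 1 + Pi.single u 1 := by
      obtain ⟨x, y, hxy, hxp⟩ := eq_single_add_single_of_sum_eq_two (h.zeroOne.transpose p) hp2
      have hrxy : r = x ∨ r = y := by
        have := congrFun hxp r
        rw [Matrix.transpose_apply, hArp] at this
        by_contra! hc
        simp [hc.1, hc.2] at this
      rcases hrxy with rfl | rfl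
      · exact ⟨y, hxy, hxp⟩
      · exact ⟨x, hxy.symm, by rw [hxp, add_comm]⟩
    have hAup : A u p = 1 := by
      have := congrFun hp u
      simpa [hru.symm] using this
    have hu : 2 ≤ rowSum A u := by
      have := h.transpose.two_le_of_rowSum (r := p) (p := u) (by omega) hAup
      rwa [Matrix.transpose_transpose] at this
    have hq : 2 ≤ rowSum A.transpose q := h.two_le_of_rowSum (by omega) hArq
    by_cases hu2 : rowSum A u = 2
    · exact h.transpose.false_of_adjacent_two (r := p) (p := r) (q := u) (u := q) hru hpq hp
        (by rw [Matrix.transpose_transpose]; exact hr)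
        (Or.inl (by rw [Matrix.transpose_transpose]; exact hu2))
    · exact h.false_of_adjacent_two hpq hru hr hp (by omega)
  obtain ⟨p, q, hpq, hr⟩ := eq_single_add_single_of_sum_eq_two (h.zeroOne r) hr2
  have hArp : A r p = 1 := by rw [hr]; simp [hpq]
  have hArq : A r q = 1 := by rw [hr]; simp [hpq.symm]
  have hp2 : 2 ≤ rowSum A.transpose p := h.two_le_of_rowSum (by omega) hArp
  have hq2 : 2 ≤ rowSum A.transpose q := h.two_le_of_rowSum (by omega) hArq
  by_cases hp : rowSum A.transpose p = 2
  · exact key p q hpq hr hp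
  by_cases hq : rowSum A.transpose q = 2
  · exact key q p hpq.symm (by rw [hr, add_comm]) hq
  refine h.false_of_add_le (x := a ^ 3) (y := a ^ 3) rfl (det_eq_add_of_row_eq hr)
      (h.le_of_total (h.zeroOne.piv _ _) 3 (by norm_num) (by rw [total_piv]; push_cast; omega))
      (h.le_of_total (h.zeroOne.piv _ _) 3 (by norm_num) (by rw [total_piv]; push_cast; omega))
      (by linarith [h.cube])

theorem three_le_of_mem (h : Critical a A) {r c : ι} (hr : 2 ≤ rowSum A r) (hc : A r c = 1) :
    3 ≤ rowSum A.transpose c := by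
  have h1 := h.two_le_of_rowSum hr hc
  have h2 := h.transpose.rowSum_ne_two c
  omega

/-- With d = 8 + k this is d a^(d+1) ≤ 1, an equality at d = 8 because a^9 = 1/8. -/
theorem eight_add_mul_pow_le (ha0 : 0 < a) (ha3 : a ^ 3 = 1 / 2) (ha : a < 4 / 5) (k : ℕ) :
    ((8 + k : ℕ) : ℝ) * a ^ (9 + k) ≤ 1 := by
  induction k with
  | zero =>
    have : a ^ 9 = 1 / 8 := by rw [show a ^ 9 = (a ^ 3) ^ 3 by ring, ha3]; norm_num
    norm_num [this]
  | succ k ih =>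
    have h1 : (0 : ℝ) < a ^ (9 + k) := pow_pos ha0 _
    have h2 : a ^ (9 + (k + 1)) = a ^ (9 + k) * a := by ring
    rw [h2]
    push_cast at *
    have h3 : (8 + ((k : ℝ) + 1)) * a ≤ 8 + k := by
      have : (0 : ℝ) ≤ k := Nat.cast_nonneg k
      nlinarith
    nlinarith

/-- In the expansion along a row with d ones, each of the d terms saves at least d + 3 - 2 = d + 1
ones. -/
theorem rowSum_le_seven (h : Critical a A) (r : ι) : rowSum A r ≤ 7 := by
  by_contra! hc
  obtain ⟨k, hk⟩ : ∃ k : ℕ, rowSum A r = (8 + k : ℕ) := ⟨(rowSum A r - 8).toNat, by omega⟩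
  refine h.false_of_le (x := ((8 + k : ℕ) : ℝ) * a ^ (9 + k)) ?_
    (eight_add_mul_pow_le h.pos h.cube h.lt_four_fifths k)
  rw [det_eq_sum_piv A r]
  simp only [Int.cast_sum, Int.cast_mul]
  refine (Finset.abs_sum_le_sum_abs _ _).trans ?_
  have h1 : ∀ c ∈ Finset.univ, |(A r c : ℝ) * ((piv A r c).det : ℝ)| ≤
      (A r c : ℝ) * (a ^ ((Fintype.card ι : ℤ) - total A) * a ^ (9 + k)) := by
    intro c _
    rw [abs_mul, abs_of_nonneg (by exact_mod_cast h.nonneg r c)]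
    rcases h.zeroOne r c with h0 | h1
    · simp [h0]
    · rw [h1]
      simp only [Int.cast_one, one_mul]
      refine h.le_of_total (h.zeroOne.piv _ _) _ (by omega) ?_
      have := h.three_le_of_mem (r := r) (by omega) h1
      rw [total_piv]
      push_cast
      omega
  refine (Finset.sum_le_sum h1).trans ?_
  rw [← Finset.sum_mul]
  have h2 : (∑ c, (A r c : ℝ)) = ((8 + k : ℕ) : ℝ) := by
    have : ((rowSum A r : ℤ) : ℝ) = ((8 + k : ℕ) : ℝ) := by rw [hk]; simp
    rwa [rowSum, Int.cast_sum] at this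
  rw [h2]
  apply le_of_eq
  ring

end Critical
-- Common ones of two rows
/-- The number of common ones of rows `r` and `s` of a zero-one matrix. -/
def overlap (A : Matrix ι ι ℤ) (r s : ι) : ℤ := ∑ c, A r c * A s c

theorem overlap_comm (A : Matrix ι ι ℤ) (r s : ι) : overlap A r s = overlap A s r :=
  Finset.sum_congr rfl fun _ _ => mul_comm _ _

namespace Critical

variable {a : ℝ} {A : Matrix ι ι ℤ}

theorem mul_zeroOne (h : Critical a A) (r s c : ι) : A r c * A s c = 0 ∨ A r c * A s c = 1 := by
  rcases h.zeroOne r c with h1 | h1 <;> rcases h.zeroOne s c with h2 | h2 <;> simp [h1, h2]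

theorem sub_mul_zeroOne (h : Critical a A) (r s c : ι) :
    A r c - A r c * A s c = 0 ∨ A r c - A r c * A s c = 1 := by
  rcases h.zeroOne r c with h1 | h1 <;> rcases h.zeroOne s c with h2 | h2 <;> simp [h1, h2]

theorem overlap_lt_rowSum (h : Critical a A) {r s : ι} (hrs : r ≠ s) :
    overlap A r s < rowSum A r := by
  by_contra! hc
  have h0 : ∑ c, (A r c - A r c * A s c) = 0 := by
    have h1 : 0 ≤ ∑ c, (A r c - A r c * A s c) := Finset.sum_nonneg fun c _ => by
      rcases h.sub_mul_zeroOne r s c with h | h <;> omega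
    rw [Finset.sum_sub_distrib] at *
    unfold overlap rowSum at hc
    omega
  rw [Finset.sum_eq_zero_iff_of_nonneg (fun c _ => by
      rcases h.sub_mul_zeroOne r s c with h | h <;> omega)] at h0
  refine h.not_row_le hrs fun j => ?_
  have := h0 j (Finset.mem_univ j)
  rcases h.zeroOne r j with h1 | h1 <;> rcases h.zeroOne s j with h2 | h2 <;> simp_all

theorem det_eq_add_overlap (r s : ι) :
    A.det = (A.updateRow r (fun c => A r c * A s c)).det +
      (A.updateRow r (fun c => A r c - A r c * A s c)).det := by
  rw [← Matrix.det_updateRow_add]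
  have : ((fun c => A r c * A s c) + fun c => A r c - A r c * A s c) = A r := by
    ext c; simp
  rw [this, Matrix.updateRow_eq_self]

/-- The row operation subtracting the common part of two rows. -/
theorem abs_det_updateRow_overlap_le (h : Critical a A) {r s : ι} (hrs : r ≠ s) (t : ℕ)
    (ht : 0 < t) (htr : (t : ℤ) ≤ rowSum A r) :
    |((A.updateRow r (fun c => A r c * A s c)).det : ℝ)| ≤
      a ^ ((Fintype.card ι : ℤ) - total A) * a ^ t := by
  have hBs : (A.updateRow r (fun c => A r c * A s c)) s = A s := Matrix.updateRow_ne hrs.symm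
  have hBr : (A.updateRow r (fun c => A r c * A s c)) r = fun c => A r c * A s c :=
    Matrix.updateRow_self
  have hBz := h.zeroOne.updateRow r (h.mul_zeroOne r s)
  have h3 : total (A.updateRow r (fun c => A r c * A s c)) =
    total A - rowSum A r + ∑ c, A r c * A s c := total_updateRow A r _
  generalize A.updateRow r (fun c => A r c * A s c) = B at *
  -- Row r has lost its ones outside s; subtracting it from row s loses the overlap as well.
  -- Together this saves `rowSum A r` ones.
  rw [← Matrix.det_updateRow_add_smul_self B hrs.symm (-1)]
  have hv : B s + (-1 : ℤ) • B r = fun c => A s c - A s c * A r c := by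
    rw [hBs, hBr]; ext c; simp [mul_comm]; ring
  rw [hv]
  refine h.le_of_total (hBz.updateRow _ (h.sub_mul_zeroOne s r)) t ht ?_
  rw [total_updateRow, h3, Finset.sum_sub_distrib]
  have h1 : rowSum B s = ∑ c, A s c := by unfold rowSum; rw [hBs]
  have h2 := overlap_comm A r s
  unfold overlap at h2
  omega

/-- Split row r, with d ones, into the part shared with s and the rest; these save d and o =
`overlap A r s` ones. Since a^4 + a^3 < 1 and a^5 + a^2 < 1, the cases o ≥ 3, and o = 2 with d ≥ 5,
are impossible. For smaller d the one or two remaining ones are pivoted on separately; only d = 4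
with both their columns of sum three escapes, since a^4 + 2 a^5 > 1. -/
theorem overlap_cases (h : Critical a A) {r s : ι} (hrs : r ≠ s) (hov : 2 ≤ overlap A r s) :
    overlap A r s = 2 ∧ rowSum A r = 4 ∧
      ∀ i, A r i = 1 → A s i = 0 → rowSum A.transpose i = 3 := by
  have ha := h.lt_four_fifths
  have ha0 := h.pos
  have ha3 := h.cube
  have ha4 : a ^ 4 = a / 2 := by rw [show a ^ 4 = a * a ^ 3 by ring, ha3]; ring
  have ha5 : a ^ 5 = a ^ 2 / 2 := by rw [show a ^ 5 = a ^ 2 * a ^ 3 by ring, ha3]; ring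
  have ha6 : a ^ 6 = 1 / 4 := by rw [show a ^ 6 = (a ^ 3) ^ 2 by ring, ha3]; norm_num
  have hlt := h.overlap_lt_rowSum hrs
  have hz := h.zeroOne.updateRow r (h.sub_mul_zeroOne r s)
  have hE : total (A.updateRow r (fun c => A r c - A r c * A s c)) =
      total A - overlap A r s := by
    rw [total_updateRow, Finset.sum_sub_distrib]
    unfold rowSum overlap
    ring
  have hsum : ∑ c, (A r c - A r c * A s c) = rowSum A r - overlap A r s := by
    rw [Finset.sum_sub_distrib]; rfl
  have hpiv : ∀ i, A r i = 1 → ∀ t : ℕ, 0 < t → (t : ℤ) + 2 ≤ rowSum A r + rowSum A.transpose i →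
      |((A.updateRow r (Pi.single i 1)).det : ℝ)| ≤
        a ^ ((Fintype.card ι : ℤ) - total A) * a ^ t := by
    intro i hi t ht hle
    rw [← det_piv_eq_updateRow]
    refine h.le_of_total (h.zeroOne.piv _ _) t ht ?_
    rw [total_piv, hi]
    omega
  have hmem : ∀ i, A r i - A r i * A s i = 1 → A r i = 1 ∧ A s i = 0 := by
    intro i
    rcases h.zeroOne r i with h1 | h1 <;> rcases h.zeroOne s i with h2 | h2 <;> simp [h1, h2]
  by_cases h3 : 3 ≤ overlap A r s
  · exfalso
    refine h.false_of_add_le (x := a ^ 4) (y := a ^ 3) rfl (det_eq_add_overlap r s)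
      (h.abs_det_updateRow_overlap_le hrs 4 (by norm_num) (by push_cast; omega))
      (h.le_of_total hz 3 (by norm_num) (by push_cast; omega)) (by linarith)
  have h2 : overlap A r s = 2 := by omega
  by_cases h5 : 5 ≤ rowSum A r
  · exfalso
    refine h.false_of_add_le (x := a ^ 5) (y := a ^ 2) rfl (det_eq_add_overlap r s)
      (h.abs_det_updateRow_overlap_le hrs 5 (by norm_num) (by push_cast; omega))
      (h.le_of_total hz 2 (by norm_num) (by push_cast; omega)) (by nlinarith)
  by_cases h4 : rowSum A r = 3
  · exfalso
    obtain ⟨i, hi⟩ := eq_single_of_sum_eq_one (h.sub_mul_zeroOne r s) (by rw [hsum]; omega)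
    obtain ⟨hri, -⟩ := hmem i (by have := congrFun hi i; simpa using this)
    have hi3 := h.three_le_of_mem (r := r) (by omega) hri
    refine h.false_of_add_le (x := a ^ 3) (y := a ^ 4) rfl (det_eq_add_overlap r s)
      (h.abs_det_updateRow_overlap_le hrs 3 (by norm_num) (by push_cast; omega))
      (by rw [hi]; exact hpiv i hri 4 (by norm_num) (by push_cast; omega)) (by linarith)
  have h4 : rowSum A r = 4 := by omega
  refine ⟨h2, h4, ?_⟩
  obtain ⟨i, j, hij, hf⟩ := eq_single_add_single_of_sum_eq_two (h.sub_mul_zeroOne r s)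
    (by rw [hsum]; omega)
  have hi1 : A r i - A r i * A s i = 1 := by have := congrFun hf i; simpa [hij] using this
  have hj1 : A r j - A r j * A s j = 1 := by have := congrFun hf j; simpa [hij.symm] using this
  have hi3 := h.three_le_of_mem (r := r) (by omega) (hmem i hi1).1
  have hj3 := h.three_le_of_mem (r := r) (by omega) (hmem j hj1).1
  have hdet : (A.updateRow r (fun c => A r c - A r c * A s c)).det =
      (A.updateRow r (Pi.single i 1)).det + (A.updateRow r (Pi.single j 1)).det := by
    rw [hf, Matrix.det_updateRow_add]
  -- A column with four or more ones improves one of the two savings to 6, and a^4 + a^5 + a^6 < 1.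
  have hbig : ∀ t u : ℕ, 0 < t → 0 < u → (t : ℤ) + 2 ≤ 4 + rowSum A.transpose i →
      (u : ℤ) + 2 ≤ 4 + rowSum A.transpose j → a ^ t + a ^ u = a ^ 5 + a ^ 6 → False := by
    intro t u ht hu hti huj htu
    refine h.false_of_add_le (x := a ^ 4) (y := a ^ t + a ^ u) rfl (det_eq_add_overlap r s)
      (h.abs_det_updateRow_overlap_le hrs 4 (by norm_num) (by push_cast; omega)) ?_ (by nlinarith)
    rw [hdet, Int.cast_add, mul_add]
    exact (abs_add_le _ _).trans (add_le_add
      (hpiv i (hmem i hi1).1 t ht (by omega)) (hpiv j (hmem j hj1).1 u hu (by omega)))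
  intro c hrc hsc
  have hc : c = i ∨ c = j := by
    have := congrFun hf c
    simp only [hrc, hsc] at this
    by_contra! hc
    simp [hc.1, hc.2] at this
  by_contra hne
  rcases hc with rfl | rfl
  · exact hbig 6 5 (by norm_num) (by norm_num) (by push_cast; omega) (by push_cast; omega)
      (by ring)
  · exact hbig 5 6 (by norm_num) (by norm_num) (by push_cast; omega) (by push_cast; omega) rfl

theorem overlap_le_two (h : Critical a A) {r s : ι} (hrs : r ≠ s) : overlap A r s ≤ 2 := by
  by_contra! hc
  have := (h.overlap_cases hrs (by omega)).1
  omega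

theorem overlap_nonneg (h : Critical a A) (r s : ι) : 0 ≤ overlap A r s :=
  Finset.sum_nonneg fun c _ => mul_nonneg (h.nonneg r c) (h.nonneg s c)

theorem overlap_self (h : Critical a A) (r : ι) : overlap A r r = rowSum A r := by
  refine Finset.sum_congr rfl fun c _ => ?_
  rcases h.zeroOne r c with h1 | h1 <;> simp [h1]

/-- A row has at most three other rows meeting it twice. -/
theorem card_overlap_two_le (h : Critical a A) (r : ι) :
    (Finset.univ.filter fun s => s ≠ r ∧ overlap A r s = 2).card ≤ 3 := by
  set P := Finset.univ.filter fun s => s ≠ r ∧ overlap A r s = 2 with hP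
  rcases P.eq_empty_or_nonempty with h0 | ⟨s, hs⟩
  · simp [h0]
  simp only [hP, Finset.mem_filter, Finset.mem_univ, true_and] at hs
  obtain ⟨hsr, hs2⟩ := hs
  obtain ⟨p, q, hpq, hf⟩ := eq_single_add_single_of_sum_eq_two (h.mul_zeroOne r s) hs2
  have hout := (h.overlap_cases hsr.symm hs2.ge).2.2
  -- Columns x and y share the two rows r and t, so `overlap_cases` for the transpose gives column x
  -- four ones.
  have hcol : ∀ t, t ≠ r → ∀ x y, x ≠ y →
      (fun c => A r c * A t c) = Pi.single x 1 + Pi.single y 1 → rowSum A.transpose x = 4 := by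
    intro t htr x y hxy hf
    have hx : A r x * A t x = 1 := by have := congrFun hf x; simpa [hxy] using this
    have hy : A r y * A t y = 1 := by have := congrFun hf y; simpa [hxy.symm] using this
    refine (h.transpose.overlap_cases hxy ?_).2.1
    unfold overlap
    have hsub : ({r, t} : Finset ι) ⊆ Finset.univ := Finset.subset_univ _
    have := Finset.sum_le_sum_of_subset_of_nonneg (f := fun c => A c x * A c y) hsub
      (fun c _ _ => mul_nonneg (h.nonneg c x) (h.nonneg c y))
    rw [Finset.sum_pair htr.symm] at this
    rcases h.zeroOne r x with h1 | h1 <;> rcases h.zeroOne t x with h2 | h2 <;>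
      rcases h.zeroOne r y with h3 | h3 <;> rcases h.zeroOne t y with h4 | h4 <;>
      simp_all
  have hp4 : rowSum A.transpose p = 4 := hcol s hsr p q hpq hf
  have hrp : A r p = 1 := by
    have : A r p * A s p = 1 := by have := congrFun hf p; simpa [hpq] using this
    rcases h.zeroOne r p with h1 | h1
    · simp [h1] at this
    · exact h1
  have hmem : ∀ t ∈ P, A t p = 1 := by
    intro t ht
    simp only [hP, Finset.mem_filter, Finset.mem_univ, true_and] at ht
    obtain ⟨x, y, hxy, hg⟩ := eq_single_add_single_of_sum_eq_two (h.mul_zeroOne r t) ht.2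
    -- The ones of row r outside s lie in columns of sum three, so every row meeting r twice meets
    -- it in the same columns p and q.
    have key : ∀ x, A r x * A t x = 1 → rowSum A.transpose x = 4 → x = p ∨ x = q := by
      intro x hx hx4
      have hrx : A r x = 1 := by
        rcases h.zeroOne r x with h1 | h1
        · simp [h1] at hx
        · exact h1
      have hsx : A s x = 1 := by
        rcases h.zeroOne s x with h1 | h1
        · have := hout x hrx h1; omega
        · exact h1
      have := congrFun hf x
      simp only [hrx, hsx] at this
      by_contra! hc
      simp [hc.1, hc.2] at this
    have hx : A r x * A t x = 1 := by have := congrFun hg x; simpa [hxy] using this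
    have hy : A r y * A t y = 1 := by have := congrFun hg y; simpa [hxy.symm] using this
    have hx' := key x hx (hcol t ht.1 x y hxy hg)
    have hy' := key y hy (hcol t ht.1 y x hxy.symm (by rw [hg, add_comm]))
    have : A r p * A t p = 1 := by
      rcases hx' with rfl | rfl
      · exact hx
      · rcases hy' with rfl | rfl
        · exact hy
        · exact absurd rfl hxy
    rw [hrp, one_mul] at this
    exact this
  have hrP : r ∉ P := by simp [hP]
  have hle : ∑ t ∈ insert r P, A t p ≤ rowSum A.transpose p :=
    Finset.sum_le_sum_of_subset_of_nonneg (Finset.subset_univ _) (fun t _ _ => h.nonneg t p)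
  rw [Finset.sum_insert hrP, Finset.sum_congr rfl hmem, hrp, hp4] at hle
  simp at hle
  omega

theorem sum_overlap_eq (r : ι) :
    ∑ s, overlap A r s = ∑ c, A r c * rowSum A.transpose c := by
  unfold overlap rowSum
  rw [Finset.sum_comm]
  simp_rw [Finset.mul_sum]
  rfl

theorem overlap_le_one (h : Critical a A) {r s : ι} (hr : rowSum A r = 3) (hrs : r ≠ s) :
    overlap A r s ≤ 1 := by
  by_contra! hc
  have := (h.overlap_cases hrs (by omega)).2.1
  omega

/-- A row with three ones meets at least six other rows. -/
theorem six_le_card_overlap_one (h : Critical a A) {r : ι} (hr : rowSum A r = 3) :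
    6 ≤ (Finset.univ.filter fun s => s ≠ r ∧ overlap A r s = 1).card := by
  -- Three columns with at least three ones each. Row r itself accounts for three of the nine, and
  -- any other row for at most one.
  have h1 : 9 ≤ ∑ s, overlap A r s := by
    rw [sum_overlap_eq]
    have : ∑ c, A r c * 3 ≤ ∑ c, A r c * rowSum A.transpose c := by
      refine Finset.sum_le_sum fun c _ => ?_
      rcases h.zeroOne r c with h0 | h0
      · simp [h0]
      · have := h.three_le_of_mem (by omega) h0
        simp [h0, this]
    rw [← Finset.sum_mul] at this
    unfold rowSum at hr
    rw [hr] at this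
    omega
  rw [← Finset.add_sum_erase _ _ (Finset.mem_univ r), h.overlap_self, hr] at h1
  have h2 : ∑ s ∈ Finset.univ.erase r, overlap A r s =
      ∑ s ∈ Finset.univ.erase r, if overlap A r s = 1 then 1 else 0 := by
    refine Finset.sum_congr rfl fun s hs => ?_
    have h3 := h.overlap_le_one hr (Finset.ne_of_mem_erase hs).symm
    have h4 := h.overlap_nonneg r s
    split_ifs <;> omega
  rw [h2, ← Finset.sum_filter] at h1
  have h3 : (Finset.univ.erase r).filter (fun s => overlap A r s = 1) =
      Finset.univ.filter fun s => s ≠ r ∧ overlap A r s = 1 := by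
    ext s; simp
  rw [h3, Finset.sum_const, nsmul_one] at h1
  omega

end Critical
-- Principal minors of positive definite matrices
open Matrix

/-- The matrix agreeing with `M` on `T × T` and with the identity elsewhere. -/
def restrict (M : Matrix ι ι ℝ) (T : Finset ι) : Matrix ι ι ℝ :=
  Matrix.of fun i j => if i ∈ T ∧ j ∈ T then M i j else if i = j then 1 else 0

theorem restrict_apply (M : Matrix ι ι ℝ) (T : Finset ι) (i j : ι) :
    restrict M T i j = if i ∈ T ∧ j ∈ T then M i j else if i = j then 1 else 0 := rfl

theorem restrict_empty (M : Matrix ι ι ℝ) : restrict M ∅ = 1 := by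
  ext i j
  simp [restrict_apply, Matrix.one_apply]

theorem restrict_univ (M : Matrix ι ι ℝ) : restrict M Finset.univ = M := by
  ext i j
  simp [restrict_apply]

theorem piv_restrict_insert (M : Matrix ι ι ℝ) {T : Finset ι} {i : ι} (hi : i ∉ T) :
    piv (restrict M (insert i T)) i i = restrict M T := by
  ext j l
  rw [piv_apply, restrict_apply, restrict_apply]
  by_cases hj : j = i <;> by_cases hl : l = i
  · subst hj; subst hl; simp [hi]
  · subst hj; simp [hi, hl, Ne.symm hl]
  · subst hl; simp [hi, hj]
  · simp [hj, hl]

theorem dotProduct_restrict_mulVec (M : Matrix ι ι ℝ) (T : Finset ι) (x : ι → ℝ) :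
    x ⬝ᵥ (restrict M T *ᵥ x) =
      (fun j => if j ∈ T then x j else 0) ⬝ᵥ (M *ᵥ fun j => if j ∈ T then x j else 0) +
        ∑ j, if j ∈ T then 0 else x j ^ 2 := by
  simp only [dotProduct, mulVec]
  rw [← Finset.sum_add_distrib]
  refine Finset.sum_congr rfl fun j _ => ?_
  by_cases hj : j ∈ T
  · simp only [hj, if_true, add_zero]
    congr 1
    refine Finset.sum_congr rfl fun l _ => ?_
    rw [restrict_apply]
    by_cases hl : l ∈ T
    · simp [hj, hl]
    · have : j ≠ l := fun h => hl (h ▸ hj)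
      simp [hl, this]
  · simp only [hj, if_false, zero_mul, zero_add]
    rw [Finset.sum_eq_single j]
    · simp [restrict_apply, hj]; ring
    · intro l _ hl
      simp [restrict_apply, hj, hl.symm]
    · simp

theorem posDef_restrict {M : Matrix ι ι ℝ} (hM : M.PosDef) (T : Finset ι) :
    (restrict M T).PosDef := by
  refine Matrix.PosDef.of_dotProduct_mulVec_pos ?_ fun x hx => ?_
  · ext i j
    have := hM.1.apply i j
    simp only [star_trivial] at this
    simp only [Matrix.conjTranspose_apply, star_trivial, restrict_apply, this]
    simp only [and_comm, eq_comm]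
  · rw [star_trivial, dotProduct_restrict_mulVec]
    have h2 : 0 ≤ ∑ j, if j ∈ T then 0 else x j ^ 2 :=
      Finset.sum_nonneg fun j _ => by split_ifs <;> positivity
    by_cases h0 : (fun j => if j ∈ T then x j else 0) = 0
    · have : ∃ j, x j ≠ 0 := by
        by_contra! hc
        exact hx (funext hc)
      obtain ⟨j, hj⟩ := this
      have hjT : j ∉ T := by
        intro hjT
        have := congrFun h0 j
        simp [hjT, hj] at this
      rw [h0]
      simp only [mulVec_zero, dotProduct_zero, zero_add]
      refine Finset.sum_pos' (fun j _ => by split_ifs <;> positivity) ⟨j, Finset.mem_univ j, ?_⟩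
      simp only [hjT, if_false]
      positivity
    · have := hM.dotProduct_mulVec_pos h0
      rw [star_trivial] at this
      linarith

/-- The determinant of a positive definite matrix is at most the complementary principal minor
times any value of the quadratic form on a vector with `i`-th coordinate one. -/
theorem det_le_det_piv_mul {M : Matrix ι ι ℝ} (hM : M.PosDef) {i : ι} {w : ι → ℝ}
    (hw : w i = 1) : M.det ≤ (piv M i i).det * (w ⬝ᵥ (M *ᵥ w)) := by
  have hdet := hM.det_pos
  have hunit : IsUnit M.det := hdet.ne'.isUnit
  set b := M⁻¹ i i with hb
  have hb0 : 0 < b := hM.inv.diag_pos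
  have hpiv : (piv M i i).det = M.det * b := by
    rw [det_piv_eq_adjugate, hb, Matrix.inv_def, Matrix.smul_apply, smul_eq_mul,
      Ring.inverse_eq_inv', ← mul_assoc, mul_inv_cancel₀ hdet.ne', one_mul]
  set v : ι → ℝ := M⁻¹ *ᵥ Pi.single i 1 with hv
  have hMv : M *ᵥ v = Pi.single i 1 := by
    rw [hv, Matrix.mulVec_mulVec, Matrix.mul_nonsing_inv _ hunit, Matrix.one_mulVec]
  have hvi : v i = b := by simp [hv, hb]
  have hsymm : v ⬝ᵥ (M *ᵥ w) = 1 := by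
    have : Mᵀ = M := by simpa using hM.1.eq
    rw [Matrix.dotProduct_mulVec, ← Matrix.mulVec_transpose, this, hMv]
    simp [hw]
  -- The vector b⁻¹ • v minimizes the form among vectors with i-th coordinate one, with minimum b⁻¹
  -- = det M / det (piv M i i).
  have h := hM.posSemidef.dotProduct_mulVec_nonneg (w - b⁻¹ • v)
  rw [star_trivial, Matrix.mulVec_sub, Matrix.mulVec_smul, hMv, sub_dotProduct, dotProduct_sub,
    dotProduct_sub, smul_dotProduct, smul_dotProduct, dotProduct_smul, dotProduct_smul, hsymm] at h
  simp only [dotProduct_single, hw, hvi, smul_eq_mul, mul_one, inv_mul_cancel₀ hb0.ne'] at h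
  have h1 : b⁻¹ ≤ w ⬝ᵥ (M *ᵥ w) := by linarith
  rw [hpiv, mul_assoc]
  have h2 : 1 ≤ b * (w ⬝ᵥ (M *ᵥ w)) := by
    rw [← mul_inv_cancel₀ hb0.ne']
    exact mul_le_mul_of_nonneg_left h1 hb0.le
  nlinarith

theorem det_restrict_insert_le {M : Matrix ι ι ℝ} (hM : M.PosDef) {T : Finset ι} {i : ι}
    (hi : i ∉ T) {w : ι → ℝ} (hw : w i = 1) (hw0 : ∀ j, j ∉ insert i T → w j = 0) :
    (restrict M (insert i T)).det ≤ (restrict M T).det * (w ⬝ᵥ (M *ᵥ w)) := by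
  have h := det_le_det_piv_mul (posDef_restrict hM (insert i T)) hw
  rw [piv_restrict_insert M hi, dotProduct_restrict_mulVec] at h
  have h1 : (fun j => if j ∈ insert i T then w j else 0) = w := by
    ext j
    split_ifs with hj
    · rfl
    · exact (hw0 j hj).symm
  have h2 : (∑ j, if j ∈ insert i T then 0 else w j ^ 2) = 0 := by
    refine Finset.sum_eq_zero fun j _ => ?_
    split_ifs with hj
    · rfl
    · rw [hw0 j hj]; ring
  rwa [h1, h2, add_zero] at h

/-- One step of Hadamard's inequality. -/
theorem det_restrict_insert_le_diag {M : Matrix ι ι ℝ} (hM : M.PosDef) {T : Finset ι} {i : ι}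
    (hi : i ∉ T) : (restrict M (insert i T)).det ≤ (restrict M T).det * M i i := by
  have h := det_restrict_insert_le hM hi (w := Pi.single i 1) (by simp) (by
    intro j hj
    have : j ≠ i := fun h => hj (by simp [h])
    simp [this])
  simpa using h

/-- The form at e_i - x equals M i i - 2 ∑ x + xᵀMx, and the hypotheses on x give xᵀMx ≤ ∑ x. -/
theorem det_restrict_insert_le_sub {M : Matrix ι ι ℝ} (hM : M.PosDef) {T N : Finset ι} {i : ι}
    (hi : i ∉ T) (hNT : N ⊆ T) (hN : ∀ j ∈ N, M i j = 1) {x : ι → ℝ} (hx : ∀ j, 0 ≤ x j)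
    (hx0 : ∀ j, j ∉ N → x j = 0) (hMx : ∀ j ∈ N, (M *ᵥ x) j ≤ 1) :
    (restrict M (insert i T)).det ≤ (restrict M T).det * (M i i - ∑ j, x j) := by
  have hiN : i ∉ N := fun h => hi (hNT h)
  have h := det_restrict_insert_le hM hi (w := Pi.single i 1 - x) (by simp [hx0 i hiN]) (by
    intro j hj
    have h1 : j ≠ i := fun h => hj (by simp [h])
    have h2 : j ∉ N := fun h => hj (Finset.mem_insert_of_mem (hNT h))
    simp [h1, hx0 j h2])
  refine h.trans (mul_le_mul_of_nonneg_left ?_ (posDef_restrict hM T).det_pos.le)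
  have h1 : (M *ᵥ x) i = ∑ j, x j := by
    simp only [mulVec, dotProduct]
    refine Finset.sum_congr rfl fun j _ => ?_
    by_cases hj : j ∈ N
    · rw [hN j hj, one_mul]
    · rw [hx0 j hj, mul_zero]
  have h2 : x ⬝ᵥ (M *ᵥ Pi.single i 1) = ∑ j, x j := by
    have : Mᵀ = M := by simpa using hM.1.eq
    rw [Matrix.dotProduct_mulVec, ← Matrix.mulVec_transpose, this, dotProduct_single, mul_one, h1]
  have h3 : x ⬝ᵥ (M *ᵥ x) ≤ ∑ j, x j := by
    refine Finset.sum_le_sum fun j _ => ?_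
    by_cases hj : j ∈ N
    · exact mul_le_of_le_one_right (hx j) (hMx j hj)
    · rw [hx0 j hj, zero_mul]
  have h4 : (Pi.single i 1 : ι → ℝ) ⬝ᵥ (M *ᵥ Pi.single i 1) = M i i := by simp
  have h5 : (Pi.single i 1 : ι → ℝ) ⬝ᵥ (M *ᵥ x) = ∑ j, x j := by simp [h1]
  rw [Matrix.mulVec_sub, sub_dotProduct, dotProduct_sub, dotProduct_sub, h2, h4, h5]
  linarith

/-! ### Gram matrices -/

/-- The real Gram matrix of the rows of an integer matrix. -/
def gram (A : Matrix ι ι ℤ) : Matrix ι ι ℝ := Matrix.of fun i j => (overlap A i j : ℝ)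

theorem gram_eq (A : Matrix ι ι ℤ) :
    gram A = A.map (Int.cast : ℤ → ℝ) * (A.map (Int.cast : ℤ → ℝ))ᵀ := by
  ext i j
  simp [gram, overlap, Matrix.mul_apply]

theorem det_map_cast (A : Matrix ι ι ℤ) : (A.map (Int.cast : ℤ → ℝ)).det = (A.det : ℝ) :=
  ((Int.castRingHom ℝ).map_det A).symm

theorem det_gram (A : Matrix ι ι ℤ) : (gram A).det = (A.det : ℝ) ^ 2 := by
  rw [gram_eq, Matrix.det_mul, Matrix.det_transpose, det_map_cast, sq]

theorem posDef_gram {A : Matrix ι ι ℤ} (hA : A.det ≠ 0) : (gram A).PosDef := by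
  have hB : IsUnit (A.map (Int.cast : ℤ → ℝ)) := by
    rw [Matrix.isUnit_iff_isUnit_det, det_map_cast]
    exact (Int.cast_ne_zero.2 hA).isUnit
  rw [gram_eq]
  refine Matrix.PosDef.of_dotProduct_mulVec_pos ?_ fun x hx => ?_
  · exact Matrix.isHermitian_mul_conjTranspose_self _
  · rw [star_trivial, ← Matrix.mulVec_mulVec, Matrix.dotProduct_mulVec, ← Matrix.mulVec_transpose]
    have h0 : (A.map (Int.cast : ℤ → ℝ))ᵀ *ᵥ x ≠ 0 := by
      intro h
      apply hx
      have hinj := Matrix.mulVec_injective_of_isUnit (Matrix.isUnit_transpose _ |>.2 hB)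
      exact hinj (by rw [h, Matrix.mulVec_zero])
    set y := (A.map (Int.cast : ℤ → ℝ))ᵀ *ᵥ x
    have h1 : 0 ≤ y ⬝ᵥ y := Finset.sum_nonneg fun j _ => mul_self_nonneg _
    exact lt_of_le_of_ne h1 fun h => h0 (dotProduct_self_eq_zero.1 h.symm)

/-! ### Averaging over insertion orders -/

/-- If inserting `i` into `S` increases `F` by at most a function `g i` of the number of neighbours
of `i` in `S`, then averaging over the insertion order bounds `F` in terms of the means of `g`. -/
theorem le_sum_of_insert_le (adj : ι → ι → Prop) [∀ i, DecidablePred (adj i)] (L : Finset ι)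
    (F : Finset ι → ℝ) (g φ : ι → ℕ → ℝ)
    (hφ : ∀ (j : ι) (m : ℕ), (m : ℝ) * φ j (m - 1) + g j m = (m + 1) * φ j m)
    (hF : ∀ S i, i ∉ S → insert i S ⊆ L →
      F (insert i S) ≤ F S + g i (S.filter fun j => j ≠ i ∧ adj i j).card)
    (S : Finset ι) (hS : S ⊆ L) :
    F S ≤ F ∅ + ∑ j ∈ S, φ j (S.filter fun i => i ≠ j ∧ adj j i).card := by
  induction S using Finset.strongInduction with
  | H S ih =>
    rcases S.eq_empty_or_nonempty with rfl | hne
    · simp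
    set m : ι → ℕ := fun j => (S.filter fun i => i ≠ j ∧ adj j i).card with hm
    have hcard : ∀ i ∈ S, ∀ j, ((S.erase i).filter fun l => l ≠ j ∧ adj j l).card =
        if i ≠ j ∧ adj j i then m j - 1 else m j := by
      intro i hi j
      rw [Finset.filter_erase]
      split_ifs with h
      · rw [Finset.card_erase_of_mem (by simp [hi, h])]
      · rw [Finset.erase_eq_of_notMem (by simp only [Finset.mem_filter]; exact fun hh => h hh.2)]
    have h1 : ∀ i ∈ S, F S ≤ F ∅ + ∑ j ∈ S.erase i,
        φ j (if i ≠ j ∧ adj j i then m j - 1 else m j) + g i (m i) := by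
      intro i hi
      have h2 := hF (S.erase i) i (Finset.notMem_erase i S) (by rwa [Finset.insert_erase hi])
      rw [Finset.insert_erase hi, hcard i hi i] at h2
      have h3 := ih (S.erase i) (Finset.erase_ssubset hi) ((Finset.erase_subset i S).trans hS)
      simp only [hcard i hi] at h3
      simp only [ne_eq, not_true_eq_false, false_and, if_false] at h2
      simp only [ne_eq] at h3 ⊢
      linarith
    have h4 := Finset.sum_le_sum h1
    simp only [Finset.sum_add_distrib, Finset.sum_const, nsmul_eq_mul] at h4
    have h5 : ∑ i ∈ S, ∑ j ∈ S.erase i, φ j (if i ≠ j ∧ adj j i then m j - 1 else m j) =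
        ∑ j ∈ S, ∑ i ∈ S.erase j, φ j (if i ≠ j ∧ adj j i then m j - 1 else m j) := by
      refine Finset.sum_comm' fun i j => ?_
      simp only [Finset.mem_erase, ne_eq]
      tauto
    -- As the last inserted element i varies, i = j contributes g j m, the m neighbours of j
    -- contribute φ j (m - 1) each and the others φ j m. At m = 0 the truncated m - 1 has
    -- coefficient zero.
    have h6 : ∀ j ∈ S, ∑ i ∈ S.erase j, φ j (if i ≠ j ∧ adj j i then m j - 1 else m j) +
        g j (m j) = S.card * φ j (m j) := by
      intro j hj
      have h7 : ∀ i ∈ S.erase j, φ j (if i ≠ j ∧ adj j i then m j - 1 else m j) =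
          φ j (m j) + if i ≠ j ∧ adj j i then φ j (m j - 1) - φ j (m j) else 0 := by
        intro i _
        split_ifs <;> ring
      have h12 : (S.erase j).filter (fun i => i ≠ j ∧ adj j i) =
          S.filter fun i => i ≠ j ∧ adj j i := by
        ext i
        simp only [Finset.mem_filter, Finset.mem_erase]
        tauto
      rw [Finset.sum_congr rfl h7, Finset.sum_add_distrib, ← Finset.sum_filter, h12,
        Finset.sum_const, Finset.sum_const]
      change (S.erase j).card • φ j (m j) + m j • (φ j (m j - 1) - φ j (m j)) + g j (m j) = _
      have h8 := hφ j (m j)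
      have h9 : ((S.erase j).card : ℝ) + 1 = S.card := by
        exact_mod_cast Finset.card_erase_add_one hj
      simp only [nsmul_eq_mul]
      rw [← h9]
      linarith
    rw [h5] at h4
    have h10 := Finset.sum_congr rfl h6
    rw [Finset.sum_add_distrib, ← Finset.mul_sum] at h10
    have hpos : (0 : ℝ) < S.card := by exact_mod_cast hne.card_pos
    have h11 : (S.card : ℝ) * F S ≤ S.card * (F ∅ + ∑ j ∈ S, φ j (m j)) := by
      rw [mul_add]; linarith
    exact le_of_mul_le_mul_left h11 hpos

/-! ### Numerical bounds for the mean gain -/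

theorem add_two_mul_pow_three_le (k : ℕ) : (6 + 3 * (7 + k)) ^ 3 ≤ 2 ^ (7 + k) * 6 ^ 3 := by
  induction k with
  | zero => norm_num
  | succ k ih =>
    have : 2 ^ (7 + (k + 1)) * 6 ^ 3 = 2 * (2 ^ (7 + k) * 6 ^ 3) := by ring
    rw [this]
    nlinarith [sq_nonneg k, mul_nonneg (sq_nonneg k) (Nat.zero_le k)]

/-- The ratio (6 + h + 3M) / (6 + h) decreases in h, so the least admissible h decides: 0 if M ≥ 7,
and 7 - M otherwise. -/
theorem pow_three_le_two_pow_mul {h M : ℕ} (hM : 1 ≤ M) (hhM : 7 ≤ h + M) :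
    (6 + h + 3 * M) ^ 3 ≤ 2 ^ M * (6 + h) ^ 3 := by
  obtain ⟨h₀, k, rfl, h7⟩ : ∃ h₀ k, h = h₀ + k ∧
      (6 + h₀ + 3 * M) ^ 3 ≤ 2 ^ M * (6 + h₀) ^ 3 := by
    by_cases hM7 : 7 ≤ M
    · refine ⟨0, h, by omega, ?_⟩
      obtain ⟨k, rfl⟩ := Nat.exists_eq_add_of_le hM7
      simpa using add_two_mul_pow_three_le k
    · refine ⟨7 - M, h + M - 7, by omega, ?_⟩
      interval_cases M <;> norm_num
  have h8 : (6 + (h₀ + k) + 3 * M) * (6 + h₀) ≤ (6 + h₀ + 3 * M) * (6 + (h₀ + k)) := by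
    nlinarith [Nat.zero_le (M * k)]
  have h9 : ((6 + (h₀ + k) + 3 * M) ^ 3) * (6 + h₀) ^ 3 ≤
      (2 ^ M * (6 + (h₀ + k)) ^ 3) * (6 + h₀) ^ 3 := by
    calc _ = ((6 + (h₀ + k) + 3 * M) * (6 + h₀)) ^ 3 := by ring
      _ ≤ ((6 + h₀ + 3 * M) * (6 + (h₀ + k))) ^ 3 := Nat.pow_le_pow_left h8 3
      _ = (6 + h₀ + 3 * M) ^ 3 * (6 + (h₀ + k)) ^ 3 := by ring
      _ ≤ (2 ^ M * (6 + h₀) ^ 3) * (6 + (h₀ + k)) ^ 3 := Nat.mul_le_mul_right _ h7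
      _ = _ := by ring
  exact Nat.le_of_mul_le_mul_right h9 (by positivity)

/-- The logarithmic gain bound for a row with three ones meeting `m` earlier rows with three ones
and `h` rows with more. -/
noncomputable def logGain (h m : ℕ) : ℝ := Real.log (2 * (9 + h + 3 * m) / (6 + h + 3 * m))

/-- The mean of `logGain h` over `0, …, m`. -/
noncomputable def meanLogGain (h m : ℕ) : ℝ :=
  Real.log (2 ^ (m + 1) * (9 + h + 3 * m) / (6 + h)) / (m + 1)

/-- The product of the factors 2(9 + h + 3m) / (6 + h + 3m) telescopes: each numerator cancels the
next denominator, up to the 2. -/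
theorem meanLogGain_rec (h m : ℕ) :
    (m : ℝ) * meanLogGain h (m - 1) + logGain h m = (m + 1) * meanLogGain h m := by
  have hm1 : ((m : ℝ) + 1) ≠ 0 := by positivity
  rw [show ((m : ℝ) + 1) * meanLogGain h m = Real.log (2 ^ (m + 1) * (9 + h + 3 * m) / (6 + h)) by
    unfold meanLogGain; field_simp]
  rcases m with _ | m
  · simp [logGain]
  · have h1 : ((m : ℝ) + 1) ≠ 0 := by positivity
    have h2 : ((m + 1 : ℕ) : ℝ) * meanLogGain h (m + 1 - 1) =
        Real.log (2 ^ (m + 1) * (9 + h + 3 * m) / (6 + h)) := by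
      unfold meanLogGain
      rw [Nat.add_sub_cancel]
      push_cast
      field_simp
    rw [h2, logGain, ← Real.log_mul (by positivity) (by positivity)]
    congr 1
    push_cast
    have h3 : (6 + (h : ℝ) + 3 * (m + 1)) ≠ 0 := by positivity
    have h4 : (6 + (h : ℝ)) ≠ 0 := by positivity
    field_simp
    ring

theorem meanLogGain_le {h m : ℕ} (hhm : 6 ≤ m + h) : meanLogGain h m ≤ 4 / 3 * Real.log 2 := by
  unfold meanLogGain
  rw [div_le_iff₀ (by positivity)]
  have h1 := pow_three_le_two_pow_mul (h := h) (M := m + 1) (by omega) (by omega)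
  have h1' : (9 + (h : ℝ) + 3 * m) ^ 3 ≤ 2 ^ (m + 1) * (6 + h) ^ 3 := by
    have : ((6 + h + 3 * (m + 1) : ℕ) : ℝ) ^ 3 ≤ 2 ^ (m + 1) * ((6 + h : ℕ) : ℝ) ^ 3 := by
      exact_mod_cast h1
    push_cast at this
    calc _ = (6 + (h : ℝ) + 3 * (m + 1)) ^ 3 := by ring
      _ ≤ _ := this
  have h2 : (2 ^ (m + 1) * (9 + (h : ℝ) + 3 * m) / (6 + h)) ^ 3 ≤ (2 ^ (m + 1)) ^ 4 := by
    rw [div_pow, div_le_iff₀ (by positivity), mul_pow]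
    calc _ ≤ ((2 : ℝ) ^ (m + 1)) ^ 3 * (2 ^ (m + 1) * (6 + h) ^ 3) := by gcongr
      _ = _ := by ring
  have h3 := Real.log_le_log (by positivity) h2
  rw [Real.log_pow, Real.log_pow, Real.log_pow] at h3
  push_cast at h3
  linarith

/-! ### The Gram determinant of a minimal counterexample -/

namespace Critical

variable {a : ℝ} {A : Matrix ι ι ℤ}

/-- In `det_restrict_insert_le_sub`, give weight 3/Z to neighbours with three ones and 1/Z to the
others. The weights sum to 1 - 6/Z, leaving room 6/Z for the surplus at a neighbour j. That surplus
is 2 · 3/Z for three ones, at most (7 - 1)/Z for another row without double overlaps, and at most (3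
+ 3)/Z for a row with double overlaps, which has four ones and at most three of them. -/
theorem det_restrict_gram_insert_le (h : Critical a A) {T : Finset ι} {i : ι} (hi : i ∉ T)
    (hi3 : rowSum A i = 3) {m k : ℕ}
    (hm : (T.filter fun j => overlap A i j = 1 ∧ rowSum A j = 3).card = m)
    (hk : (T.filter fun j => overlap A i j = 1 ∧ rowSum A j ≠ 3).card = k) :
    (restrict (gram A) (insert i T)).det ≤
      (restrict (gram A) T).det * (2 * (9 + k + 3 * m) / (6 + k + 3 * m)) := by
  set Z : ℝ := 6 + k + 3 * m with hZ
  have hZ0 : 0 < Z := by positivity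
  set N := T.filter fun j => overlap A i j = 1 with hN
  set x : ι → ℝ := fun j => if j ∈ N then (if rowSum A j = 3 then 3 / Z else 1 / Z) else 0 with hx
  have hx0 : ∀ j, 0 ≤ x j := by
    intro j
    simp only [hx]
    split_ifs <;> positivity
  have hX : ∑ j, x j = (3 * m + k) / Z := by
    simp only [hx]
    rw [← Finset.sum_filter, Finset.filter_mem_eq_inter, Finset.univ_inter, Finset.sum_ite,
      Finset.sum_const, Finset.sum_const, hN, Finset.filter_filter, Finset.filter_filter, hm, hk]
    simp only [nsmul_eq_mul]
    ring
  have hle := det_restrict_insert_le_sub (posDef_gram h.det_ne_zero) (T := T) (N := N) hi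
    (Finset.filter_subset _ _) (fun j hj => by
      have := (Finset.mem_filter.1 hj).2
      simp [gram, this]) hx0 (fun j hj => by simp [hx, hj]) ?_
  · refine hle.trans_eq ?_
    have : gram A i i = 3 := by
      simp [gram, h.overlap_self, hi3]
    rw [this, hX]
    congr 1
    field_simp
    rw [hZ]
    ring
  intro j hj
  have hij : overlap A i j = 1 := (Finset.mem_filter.1 hj).2
  have hpt : ∀ l, gram A j l * x l ≤ x l + (if l = j then ((rowSum A j : ℝ) - 1) * x j else 0) +
      (if l ≠ j ∧ overlap A j l = 2 then x j else 0) := by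
    intro l
    have hg : gram A j l = (overlap A j l : ℝ) := rfl
    by_cases hlj : l = j
    · subst hlj
      rw [hg, h.overlap_self]
      simp
      linarith
    · rw [hg]
      by_cases h2 : overlap A j l = 2
      -- Both rows have four ones, so the second copy of x l is at most x j and can be charged to j.
      · have hj4 := (h.overlap_cases (Ne.symm hlj) h2.ge).2.1
        have hl4 := (h.overlap_cases hlj (by rw [overlap_comm]; exact h2.ge)).2.1
        have hxj : x j = 1 / Z := by simp [hx, hj, hj4]
        have hxl : x l ≤ 1 / Z := by
          simp only [hx, hl4]
          split_ifs
          · omega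
          · exact le_rfl
          · positivity
        simp only [hlj, h2, if_false, ne_eq, not_false_eq_true, and_self, if_true, hxj]
        push_cast
        linarith
      · have h3 := h.overlap_le_two (Ne.symm hlj)
        have h4 : ((overlap A j l : ℤ) : ℝ) ≤ 1 := by
          exact_mod_cast (by omega : overlap A j l ≤ 1)
        simp only [hlj, h2, if_false, and_false, add_zero]
        have := hx0 l
        nlinarith
  have hsum : (gram A *ᵥ x) j ≤ ∑ l, x l + ((rowSum A j : ℝ) - 1) * x j +
      (Finset.univ.filter fun l => l ≠ j ∧ overlap A j l = 2).card * x j := by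
    refine (Finset.sum_le_sum fun l _ => hpt l).trans_eq ?_
    rw [Finset.sum_add_distrib, Finset.sum_add_distrib,
      ← Finset.sum_filter (fun l => l ≠ j ∧ overlap A j l = 2), Finset.sum_const, nsmul_eq_mul]
    simp
  refine hsum.trans ?_
  rw [hX]
  have hone : (3 * (m : ℝ) + k) / Z + 6 / Z = 1 := by
    rw [← add_div, div_eq_one_iff_eq hZ0.ne', hZ]
    ring
  have key : ((rowSum A j : ℝ) - 1) * x j +
      (Finset.univ.filter fun l => l ≠ j ∧ overlap A j l = 2).card * x j ≤ 6 / Z := by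
    rcases Nat.eq_zero_or_pos (Finset.univ.filter fun l => l ≠ j ∧ overlap A j l = 2).card with
      h0 | hpos
    · rw [h0]
      by_cases hj3 : rowSum A j = 3
      · have hxj : x j = 3 / Z := by simp [hx, hj, hj3]
        rw [hxj, hj3]
        apply le_of_eq
        push_cast
        ring
      · have hxj : x j = 1 / Z := by simp [hx, hj, hj3]
        have h7 : ((rowSum A j : ℤ) : ℝ) ≤ 7 := by exact_mod_cast h.rowSum_le_seven j
        rw [hxj, Nat.cast_zero, zero_mul, add_zero, mul_one_div]
        exact div_le_div_of_nonneg_right (by linarith) hZ0.le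
    · have h3 := h.card_overlap_two_le j
      obtain ⟨l, hl⟩ := Finset.card_pos.1 hpos
      simp only [Finset.mem_filter, Finset.mem_univ, true_and] at hl
      have hj4 := (h.overlap_cases hl.1.symm hl.2.ge).2.1
      have hxj : x j = 1 / Z := by simp [hx, hj, hj4]
      have h3' : ((Finset.univ.filter fun l => l ≠ j ∧ overlap A j l = 2).card : ℝ) ≤ 3 := by
        exact_mod_cast h3
      rw [hxj, hj4, mul_one_div, mul_one_div, ← add_div]
      refine div_le_div_of_nonneg_right ?_ hZ0.le
      push_cast
      linarith
  linarith

/-- Amounts to d^3 ≤ 4^(d-1), which fails only at d = 2 and d = 3 among the values up to seven. -/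
theorem log_rowSum_le (h : Critical a A) {i : ι} (hi : rowSum A i ≠ 3) :
    Real.log (rowSum A i) ≤ 2 / 3 * ((rowSum A i : ℝ) - 1) * Real.log 2 := by
  have h1 := h.one_le_rowSum i
  have h2 := h.rowSum_ne_two i
  have h7 := h.rowSum_le_seven i
  generalize rowSum A i = d at *
  have key : ∀ d e : ℕ, 0 < d → d ^ 3 ≤ 2 ^ (2 * e) → (d : ℝ) - 1 = e →
      Real.log d ≤ 2 / 3 * ((d : ℝ) - 1) * Real.log 2 := by
    intro d e hd hde he
    have hd0 : (0 : ℝ) < d := by exact_mod_cast hd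
    have h8 : ((d : ℝ)) ^ 3 ≤ 2 ^ (2 * e) := by exact_mod_cast hde
    have h9 := Real.log_le_log (by positivity) h8
    rw [Real.log_pow, Real.log_pow] at h9
    push_cast at h9
    rw [he]
    linarith
  interval_cases d
  · simp
  · omega
  · omega
  · simpa using key 4 3 (by norm_num) (by norm_num) (by norm_num)
  · simpa using key 5 4 (by norm_num) (by norm_num) (by norm_num)
  · simpa using key 6 5 (by norm_num) (by norm_num) (by norm_num)
  · simpa using key 7 6 (by norm_num) (by norm_num) (by norm_num)

theorem log_det_restrict_gram_le (h : Critical a A) (T : Finset ι) :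
    Real.log (restrict (gram A) T).det ≤ ∑ i ∈ T, Real.log (rowSum A i) := by
  have hG := posDef_gram h.det_ne_zero
  induction T using Finset.induction_on with
  | empty => simp [restrict_empty]
  | insert i T hi ih =>
    have h1 := det_restrict_insert_le_diag hG hi
    have h2 : gram A i i = (rowSum A i : ℝ) := by simp [gram, h.overlap_self]
    have h3 : (0 : ℝ) < rowSum A i := by exact_mod_cast h.one_le_rowSum i
    have h4 := Real.log_le_log (posDef_restrict hG _).det_pos h1
    rw [h2, Real.log_mul (posDef_restrict hG T).det_pos.ne' h3.ne'] at h4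
    rw [Finset.sum_insert hi]
    linarith

/-- The rows in H come first, at Hadamard cost; only the insertion order of L, the rows with three
ones, is averaged. Thus k i is fixed and only the number of earlier neighbours in L varies. -/
theorem log_det_gram_le (h : Critical a A) :
    Real.log (gram A).det ≤ 2 / 3 * ((total A : ℝ) - Fintype.card ι) * Real.log 2 := by
  have hG := posDef_gram h.det_ne_zero
  set L := Finset.univ.filter fun i => rowSum A i = 3 with hL
  set H := Finset.univ.filter fun i => rowSum A i ≠ 3 with hH
  set k : ι → ℕ := fun i => (Finset.univ.filter fun j => overlap A i j = 1 ∧ rowSum A j ≠ 3).card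
    with hk
  have hmain := le_sum_of_insert_le (fun i j => overlap A i j = 1) L
    (fun S => Real.log (restrict (gram A) (H ∪ S)).det) (fun i => logGain (k i))
    (fun i => meanLogGain (k i)) (fun i => meanLogGain_rec (k i)) ?_ L subset_rfl
  · have hHL : H ∪ L = Finset.univ := by
      ext i; simp only [hH, hL, Finset.mem_union, Finset.mem_filter, Finset.mem_univ, true_and]
      tauto
    simp only [Finset.union_empty, hHL, restrict_univ] at hmain
    have h1 := h.log_det_restrict_gram_le H
    have h2 : ∑ i ∈ H, Real.log (rowSum A i) ≤
        ∑ i ∈ H, 2 / 3 * ((rowSum A i : ℝ) - 1) * Real.log 2 :=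
      Finset.sum_le_sum fun i hi => h.log_rowSum_le (by simpa [hH] using hi)
    have h3 : ∑ j ∈ L, meanLogGain (k j) (L.filter fun i => i ≠ j ∧ overlap A j i = 1).card ≤
        ∑ i ∈ L, 2 / 3 * ((rowSum A i : ℝ) - 1) * Real.log 2 := by
      refine Finset.sum_le_sum fun j hj => ?_
      have hj3 : rowSum A j = 3 := by simpa [hL] using hj
      rw [hj3]
      refine (meanLogGain_le ?_).trans_eq (by push_cast; ring)
      refine (h.six_le_card_overlap_one hj3).trans ?_
      refine (Finset.card_le_card ?_).trans (Finset.card_union_le _ _)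
      intro i
      simp only [hL, Finset.mem_union, Finset.mem_filter, Finset.mem_univ, true_and]
      tauto
    have h4 : ∑ i, 2 / 3 * ((rowSum A i : ℝ) - 1) * Real.log 2 =
        2 / 3 * ((total A : ℝ) - Fintype.card ι) * Real.log 2 := by
      rw [← Finset.sum_mul, ← Finset.mul_sum, Finset.sum_sub_distrib]
      simp [total]
    have hdisj : Disjoint H L := by
      rw [Finset.disjoint_left]
      intro i
      simp only [hH, hL, Finset.mem_filter, Finset.mem_univ, true_and]
      exact fun h1 h2 => h1 h2
    rw [← h4, ← hHL, Finset.sum_union hdisj]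
    linarith
  · intro S i hiS hSL
    have hi3 : rowSum A i = 3 := by
      have := hSL (Finset.mem_insert_self i S)
      simpa [hL] using this
    have hS3 : ∀ j ∈ S, rowSum A j = 3 := fun j hj => by
      have := hSL (Finset.mem_insert_of_mem hj)
      simpa [hL] using this
    have hiT : i ∉ H ∪ S := by simp [hH, hi3, hiS]
    have hm : ((H ∪ S).filter fun j => overlap A i j = 1 ∧ rowSum A j = 3).card =
        (S.filter fun j => j ≠ i ∧ overlap A i j = 1).card := by
      congr 1
      ext j
      simp only [hH, Finset.mem_union, Finset.mem_filter, Finset.mem_univ, true_and]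
      constructor
      · rintro ⟨h1 | h1, h2, h3⟩
        · exact absurd h3 h1
        · exact ⟨h1, fun h => hiS (h ▸ h1), h2⟩
      · rintro ⟨h1, -, h2⟩
        exact ⟨Or.inr h1, h2, hS3 j h1⟩
    have hkk : ((H ∪ S).filter fun j => overlap A i j = 1 ∧ rowSum A j ≠ 3).card = k i := by
      simp only [hk]
      congr 1
      ext j
      simp only [hH, Finset.mem_union, Finset.mem_filter, Finset.mem_univ, true_and]
      tauto
    have h1 := h.det_restrict_gram_insert_le hiT hi3 hm hkk
    have h2 := Real.log_le_log (posDef_restrict hG _).det_pos h1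
    rw [Real.log_mul (posDef_restrict hG _).det_pos.ne' (by positivity)] at h2
    simp only [Finset.union_insert]
    exact h2

theorem false (h : Critical a A) : False := by
  have h1 := h.log_det_gram_le
  rw [det_gram, ← sq_abs, Real.log_pow] at h1
  have h2 := Real.log_lt_log (zpow_pos h.pos _) h.bad
  rw [Real.log_zpow] at h2
  have h3 : 3 * Real.log a = - Real.log 2 := by
    have := congrArg Real.log h.cube
    rw [Real.log_pow, one_div, Real.log_inv] at this
    exact_mod_cast this
  have h4 : Real.log a = - Real.log 2 / 3 := by linarith
  rw [h4] at h2
  push_cast at h1 h2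
  linarith

end Critical

/-! ### The bound for all zero-one matrices -/

/-- A zero-one integer matrix with `total A` ones has determinant at most `a ^ (n - total A)`
in absolute value, where `a ^ 3 = 1 / 2`. -/
theorem abs_det_le {a : ℝ} (ha0 : 0 < a) (ha3 : a ^ 3 = 1 / 2) (A : Matrix ι ι ℤ)
    (hA : ZeroOne A) : |(A.det : ℝ)| ≤ a ^ ((Fintype.card ι : ℤ) - total A) := by
  have hnn : ∀ B : Matrix ι ι ℤ, ZeroOne B → 0 ≤ total B := fun B hB =>
    Finset.sum_nonneg fun i _ => Finset.sum_nonneg fun j _ => by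
      rcases hB i j with h | h <;> omega
  induction hN : (total A).toNat using Nat.strong_induction_on generalizing A with
  | _ N ih =>
    by_contra! hbad
    exact Critical.false
      { pos := ha0
        cube := ha3
        zeroOne := hA
        min := fun B hB hlt => by
          have h1 := hnn B hB
          have h2 := hnn A hA
          exact ih _ (by omega) B hB rfl
        bad := hbad }

theorem numNonzero_eq_sum {n : ℕ} {A : Matrix (Fin n) (Fin n) ℝ}
    (hA : ∀ i j, A i j = 0 ∨ A i j = 1) : (numNonzero A : ℝ) = ∑ i, ∑ j, A i j := by
  have h1 : {p : Fin n × Fin n | A p.1 p.2 ≠ 0} =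
      (Finset.univ.filter fun p : Fin n × Fin n => A p.1 p.2 ≠ 0 : Finset _) := by
    ext p; simp
  have h2 : ∑ i, ∑ j, A i j = ∑ p : Fin n × Fin n, A p.1 p.2 :=
    (Fintype.sum_prod_type (f := fun p : Fin n × Fin n => A p.1 p.2)).symm
  rw [numNonzero, h1, Set.ncard_coe_finset, h2, Finset.card_filter]
  push_cast
  refine Finset.sum_congr rfl fun p _ => ?_
  rcases hA p.1 p.2 with h | h <;> simp [h]

theorem abs_det_le_two_rpow {n : ℕ} {k : ℤ} {A : Matrix (Fin n) (Fin n) ℝ}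
    (hA : ∀ i j, A i j = 0 ∨ A i j = 1) (hk : (numNonzero A : ℤ) ≤ n + k) :
    |A.det| ≤ (2 : ℝ) ^ ((k : ℝ) / 3) := by
  set B : Matrix (Fin n) (Fin n) ℤ := Matrix.of fun i j => if A i j = 0 then 0 else 1 with hB
  have hBA : B.map (Int.cast : ℤ → ℝ) = A := by
    ext i j
    rcases hA i j with h | h <;> simp [hB, h]
  have hBz : ZeroOne B := by
    intro i j
    rcases hA i j with h | h <;> simp [hB, h]
  have htot : total B = numNonzero A := by
    have h1 : ((total B : ℤ) : ℝ) = (numNonzero A : ℝ) := by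
      rw [numNonzero_eq_sum hA, ← hBA]
      simp [total, rowSum]
    exact_mod_cast h1
  set a : ℝ := (2 : ℝ) ^ (-(1 / 3 : ℝ)) with ha
  have ha0 : 0 < a := by positivity
  have ha3 : a ^ 3 = 1 / 2 := by
    rw [ha, ← Real.rpow_natCast, ← Real.rpow_mul (by norm_num)]
    norm_num [Real.rpow_neg_one]
  have ha1 : a ≤ 1 := Real.rpow_le_one_of_one_le_of_nonpos (by norm_num) (by norm_num)
  have h := abs_det_le ha0 ha3 B hBz
  rw [← det_map_cast, hBA, htot, Fintype.card_fin] at h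
  -- Since a ≤ 1, having fewer than n + k ones only strengthens the bound.
  refine h.trans ((zpow_le_zpow_right_of_le_one₀ ha0 ha1
    (by omega : -k ≤ (n : ℤ) - numNonzero A)).trans_eq ?_)
  rw [ha, ← Real.rpow_intCast, ← Real.rpow_mul (by norm_num)]
  congr 1
  push_cast
  ring

/-! ### The extremal block-diagonal matrices -/

theorem circulantC_zero_or_one (i j : Fin 3) : circulantC i j = 0 ∨ circulantC i j = 1 := by
  fin_cases i <;> fin_cases j <;> simp [circulantC]

theorem det_circulantC : circulantC.det = 2 := by
  simp [circulantC, Matrix.det_fin_three]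
  norm_num

theorem sum_circulantC : ∑ i, ∑ j, circulantC i j = 6 := by
  simp [circulantC, Fin.sum_univ_three]
  norm_num

theorem diagC_zero_or_one (n k : ℕ) (h3 : 3 ∣ k) (hk : k ≤ n) (i j : Fin n) :
    diagC n k h3 hk i j = 0 ∨ diagC n k h3 hk i j = 1 := by
  unfold diagC
  rw [Matrix.reindex_apply, Matrix.submatrix_apply]
  generalize (blockIndexEquiv n k h3 hk).symm i = x
  generalize (blockIndexEquiv n k h3 hk).symm j = y
  rcases x with x | x <;> rcases y with y | y
  · rw [Matrix.fromBlocks_apply₁₁, Matrix.blockDiagonal_apply]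
    split_ifs
    · exact circulantC_zero_or_one _ _
    · exact Or.inl rfl
  · exact Or.inl rfl
  · exact Or.inl rfl
  · rw [Matrix.fromBlocks_apply₂₂, Matrix.one_apply]
    split_ifs
    · exact Or.inr rfl
    · exact Or.inl rfl

theorem sum_diagC (n k : ℕ) (h3 : 3 ∣ k) (hk : k ≤ n) :
    ∑ i, ∑ j, diagC n k h3 hk i j = n + k := by
  set M := Matrix.fromBlocks (Matrix.blockDiagonal (fun _ : Fin (k / 3) => circulantC)) 0 0
    (1 : Matrix (Fin (n - k)) (Fin (n - k)) ℝ) with hM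
  have h1 : ∑ i, ∑ j, diagC n k h3 hk i j = ∑ x, ∑ y, M x y := by
    unfold diagC
    rw [← (blockIndexEquiv n k h3 hk).sum_comp]
    refine Finset.sum_congr rfl fun x _ => ?_
    rw [← (blockIndexEquiv n k h3 hk).sum_comp]
    refine Finset.sum_congr rfl fun y _ => ?_
    simp [hM]
  rw [h1, Fintype.sum_sum_type]
  simp only [Fintype.sum_sum_type, hM, Matrix.fromBlocks_apply₁₁, Matrix.fromBlocks_apply₁₂,
    Matrix.fromBlocks_apply₂₁, Matrix.fromBlocks_apply₂₂, Matrix.zero_apply,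
    Finset.sum_const_zero, add_zero, zero_add, Fintype.sum_prod_type,
    Matrix.blockDiagonal_apply, Matrix.one_apply, Finset.sum_ite_eq, Finset.mem_univ, if_true,
    Finset.sum_const, Finset.card_univ, Fintype.card_fin, nsmul_eq_mul, mul_one]
  rw [← Finset.mul_sum, sum_circulantC, Nat.cast_sub hk, Nat.cast_div h3 (by norm_num)]
  push_cast
  ring

theorem det_diagC (n k : ℕ) (h3 : 3 ∣ k) (hk : k ≤ n) :
    (diagC n k h3 hk).det = (2 : ℝ) ^ ((k : ℝ) / 3) := by
  unfold diagC
  rw [Matrix.det_reindex_self, Matrix.det_fromBlocks_zero₂₁, Matrix.det_blockDiagonal,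
    Matrix.det_one, mul_one, Finset.prod_const, det_circulantC, Finset.card_univ, Fintype.card_fin,
    ← Real.rpow_natCast, Nat.cast_div h3 (by norm_num)]
  norm_num

end SparseDet

theorem theorem1p3 :
    (∀ (n : ℕ) (k : ℤ) (A : Matrix (Fin n) (Fin n) ℝ),
      (∀ i j, A i j = 0 ∨ A i j = 1) →
      (numNonzero A : ℤ) ≤ (n : ℤ) + k →
      |A.det| ≤ (2 : ℝ) ^ ((k : ℝ) / 3)) ∧
    (∀ (n k : ℕ) (h3 : 3 ∣ k) (hk : k ≤ n),
      (∀ i j, diagC n k h3 hk i j = 0 ∨ diagC n k h3 hk i j = 1) ∧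
      numNonzero (diagC n k h3 hk) = n + k ∧
      (diagC n k h3 hk).det = (2 : ℝ) ^ ((k : ℝ) / 3)) := by
  refine ⟨fun n k A hA hk => SparseDet.abs_det_le_two_rpow hA hk, fun n k h3 hk =>
    ⟨SparseDet.diagC_zero_or_one n k h3 hk, ?_, SparseDet.det_diagC n k h3 hk⟩⟩
  have h := SparseDet.numNonzero_eq_sum (SparseDet.diagC_zero_or_one n k h3 hk)
  rw [SparseDet.sum_diagC] at h
  exact_mod_cast h
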